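/- Let $x_1^*,\dots,x_m^*\in\mathbb{R}^n$, let $C:=\{x\in\mathbb{R}^n\mid\langle x_i^*,x\rangle\le 0,\ i=1,\dots,m\}$, and let $G(x):=N(x;C)$ be its normal cone mapping, i.e. $N(x;C)=\{v\mid\langle v,c-x\rangle\le 0\ \text{for all } c\in C\}$ if $x\in C$ and $N(x;C)=\emptyset$ if $x\notin C$. Let $f:\mathbb{R}^n\times\mathbb{R}^d\to\mathbb{R}^n$ be smooth (i.e. $C^1$) and put $$F(x,u,a):=N(x-u;C)+f(x,a),\qquad (x,u,a)\in\mathbb{R}^n\times\mathbb{R}^n\times\mathbb{R}^d.$$ For a set $\Omega$ in a Euclidean space that is locally closed around $\bar z\in\Omega$, let $N(\bar z;\Omega)$ be the limiting (Mordukhovich) normal cone: the set of limits of sequences $v_k\in\{\alpha(z_k-p)\mid\alpha\ge 0,\ p\in\Pi(z_k;\Omega)\}$ with $z_k\to\bar z$, where $\Pi(z;\Omega)$ is the set of Euclidean nearest points of $\Omega$ to $z$. For a set-valued mapping $\Phi$ with closed graph and $\bar q\in\Phi(\bar p)$, the coderivative is $D^*\Phi(\bar p,\bar q)(y):=\{v\mid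 (v,-y)\in N((\bar p,\bar q);\operatorname{gph}\Phi)\}$, with domain $\operatorname{dom}D^*\Phi(\bar p,\bar q):=\{y\mid D^*\Phi(\bar p,\bar q)(y)\neq\emptyset\}$. Let $(x,u,a)\in\mathbb{R}^n\times\mathbb{R}^n\times\mathbb{R}^d$ and $w\in F(x,u,a)$, that is, $w-f(x,a)\in G(x-u)$. Put $I:=\{i\mid\langle x_i^*,x-u\rangle=0\}$ and, for $y\in\mathbb{R}^n$, $I_0(y):=\{i\in I\mid\langle x_i^*,y\rangle=0\}$ and $I_>(y):=\{i\in I\mid\langle x_i^*,y\rangle>0\}$. Then for every $y\in\operatorname{dom}D^*G(x-u,\,w-f(x,a))$, $$D^*F(x,u,a,w)(y)\subset\Big\{\Big(\nabla_xf(x,a)^*y+\!\!\sum_{i\in I_0(y)\cup I_>(y)}\!\!\gamma_ix_i^*,\ -\!\!\sum_{i\in I_0(y)\cup I_>(y)}\!\!\gamma_ix_i^*,\ \nabla_af(x,a)^*y\Big)\ \Big|\ \gamma_i\in\mathbb{R}\ (i\in I_0(y)),\ \gamma_i\ge 0\ (i\in I_>(y))\Big\}.$$ Moreover, if the vectors $x_i^*$,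 $i\in I$, are linearly independent, then this inclusion holds as an equality for every such $y$. -/

import Mathlib

open Filter Topology

namespace Sweeping

section VariationalAnalysis

variable {X : Type*} [NormedAddCommGroup X] [InnerProductSpace ℝ X]
variable {Y : Type*} [NormedAddCommGroup Y] [InnerProductSpace ℝ Y]

/-- The normal cone of convex analysis to `C` at `x`; it is empty when `x ∉ C`. -/
def convexNormalCone (C : Set X) (x : X) : Set X :=
  {v | x ∈ C ∧ ∀ c ∈ C, inner ℝ v (c - x) ≤ 0}

/-- The (possibly multivalued) projection `Π(x; Ω)`: the nearest points of `Ω` to `x`. -/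
def projSet (Ω : Set X) (x : X) : Set X :=
  {p | p ∈ Ω ∧ ∀ q ∈ Ω, ‖x - p‖ ≤ ‖x - q‖}

/-- The (not necessarily convex) cone generated by `S`: all `α • s` with `α ≥ 0`, `s ∈ S`. -/
def coneHull (S : Set X) : Set X :=
  {v | ∃ α : ℝ, 0 ≤ α ∧ ∃ s ∈ S, v = α • s}

/-- The Kuratowski-Painlevé (sequential) outer limit of `G` at `x₀`. -/
def outerLimit (G : X → Set Y) (x₀ : X) : Set Y :=
  {y | ∃ (xs : ℕ → X) (ys : ℕ → Y), Tendsto xs atTop (𝓝 x₀) ∧ Tendsto ys atTop (𝓝 y) ∧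
    ∀ k, ys k ∈ G (xs k)}

/-- The Mordukhovich (basic, limiting) normal cone to `Ω` at `x₀`,
`Limsup_{x → x₀} cone [x - Π(x; Ω)]`, for `x₀ ∈ Ω`; it is empty when `x₀ ∉ Ω`. -/
def limitingNormalCone (Ω : Set X) (x₀ : X) : Set X :=
  {v | x₀ ∈ Ω ∧ v ∈ outerLimit (fun x => coneHull ((fun p => x - p) '' projSet Ω x)) x₀}

/-- The graph of a set-valued mapping, in the Euclidean (`ℓ²`) product. -/
def graph (F : X → Set Y) : Set (WithLp 2 (X × Y)) :=
  {q | q.snd ∈ F q.fst}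

/-- The coderivative `D*F(x₀, y₀)(y) = {v | (v, -y) ∈ N((x₀, y₀); gph F)}`. -/
def coderivative (F : X → Set Y) (x₀ : X) (y₀ : Y) (y : Y) : Set X :=
  {v | WithLp.toLp 2 (v, -y) ∈ limitingNormalCone (graph F) (WithLp.toLp 2 (x₀, y₀))}

/-- The domain of the coderivative: those `y` with `D*F(x₀, y₀)(y) ≠ ∅`. -/
def coderivativeDom (F : X → Set Y) (x₀ : X) (y₀ : Y) : Set Y :=
  {y | (coderivative F x₀ y₀ y).Nonempty}

end VariationalAnalysis

/-- `ℝⁿ` with its Euclidean structure. -/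
abbrev Euc (n : ℕ) : Type := EuclideanSpace ℝ (Fin n)

/-- `ℝⁿ × ℝⁿ × ℝᵈ` with its Euclidean structure; its points are triples `(x, u, a)`. -/
abbrev Triple (n d : ℕ) : Type := WithLp 2 (Euc n × WithLp 2 (Euc n × Euc d))

/-- The triple `(x, u, a)`. -/
def triple {n d : ℕ} (x u : Euc n) (a : Euc d) : Triple n d :=
  WithLp.toLp 2 (x, WithLp.toLp 2 (u, a))

/-- The polyhedron `C = {x | ⟨x*ᵢ, x⟩ ≤ 0 for all i}`. -/
def polyhedron {n m : ℕ} (xs : Fin m → Euc n) : Set (Euc n) :=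
  {x | ∀ i, inner ℝ (xs i) x ≤ 0}

/-- The mapping `G(x) = N(x; C)`. -/
def normalMap {n m : ℕ} (xs : Fin m → Euc n) : Euc n → Set (Euc n) :=
  fun x => convexNormalCone (polyhedron xs) x

/-- The sweeping control mapping `F(x, u, a) = N(x - u; C) + f(x, a)`. -/
def sweepingMap {n m d : ℕ} (xs : Fin m → Euc n) (f : Euc n → Euc d → Euc n) :
    Triple n d → Set (Euc n) :=
  fun z => {w | ∃ v ∈ convexNormalCone (polyhedron xs) (z.fst - z.snd.fst),
    w = v + f z.fst z.snd.snd}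

/-- The active constraint indices `I(x)`. -/
noncomputable def activeIdx {n m : ℕ} (xs : Fin m → Euc n) (x : Euc n) : Finset (Fin m) :=
  {i | inner ℝ (xs i) x = 0}

/-- `I₀(y)`: the indices `i ∈ I(x)` with `⟨x*ᵢ, y⟩ = 0`. -/
noncomputable def idxZero {n m : ℕ} (xs : Fin m → Euc n) (x y : Euc n) : Finset (Fin m) :=
  {i ∈ activeIdx xs x | inner ℝ (xs i) y = 0}

/-- `I_>(y)`: the indices `i ∈ I(x)` with `⟨x*ᵢ, y⟩ > 0`. -/
noncomputable def idxPos {n m : ℕ} (xs : Fin m → Euc n) (x y : Euc n) : Finset (Fin m) :=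
  {i ∈ activeIdx xs x | 0 < inner ℝ (xs i) y}

/-- The adjoint of the partial derivative `∇ₓ f(x, a)`, applied to `y`. -/
noncomputable def gradXAdj {n d : ℕ} (f : Euc n → Euc d → Euc n) (x : Euc n) (a : Euc d)
    (y : Euc n) : Euc n :=
  ContinuousLinearMap.adjoint (fderiv ℝ (fun x' => f x' a) x) y

/-- The adjoint of the partial derivative `∇ₐ f(x, a)`, applied to `y`. -/
noncomputable def gradAAdj {n d : ℕ} (f : Euc n → Euc d → Euc n) (x : Euc n) (a : Euc d)
    (y : Euc n) : Euc d :=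
  ContinuousLinearMap.adjoint (fderiv ℝ (fun a' => f x a') a) y

/-- The explicit set of triples
`(∇ₓ f(x, a)* y + ∑ γᵢ x*ᵢ, -∑ γᵢ x*ᵢ, ∇ₐ f(x, a)* y)`, the sums being over `I₀(y) ∪ I_>(y)`
(taken at the point `x - u`), with `γᵢ ∈ ℝ` on `I₀(y)` and `γᵢ ≥ 0` on `I_>(y)`. -/
def explicitSet {n m d : ℕ} (xs : Fin m → Euc n) (f : Euc n → Euc d → Euc n)
    (x u : Euc n) (a : Euc d) (y : Euc n) : Set (Triple n d) :=
  {z | ∃ γ : Fin m → ℝ, (∀ i ∈ idxPos xs (x - u) y, 0 ≤ γ i) ∧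
    z = triple
      (gradXAdj f x a y + ∑ i ∈ idxZero xs (x - u) y ∪ idxPos xs (x - u) y, γ i • xs i)
      (-∑ i ∈ idxZero xs (x - u) y ∪ idxPos xs (x - u) y, γ i • xs i)
      (gradAAdj f x a y)}

end Sweeping

/-! A limiting normal to the graph of F is a limit of vectors `ν k` polar to the one-sided
velocities of all curves that start at nearby graph points and run in the graph. At each such point
w - f(x,a) = ∑ lᵢ x*ᵢ with lᵢ ≥ 0 carried by the active constraints; let P be the indices with lᵢ >
0 and Q ⊇ P the active ones.

Upper estimate. Moving x and u together keeps x - u fixed and is reversible, which forces the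
gradient terms. Adding t x*ᵢ to the normal vector for i ∈ Q, and subtracting it for i ∈ P, fixes the
sign of ⟨x*ᵢ, y⟩ in the limit: nonnegative on Q, zero on P. Moving u alone shows that the negated
u-component is polar to the critical cone {h | ⟨x*ᵢ, h⟩ = 0 on P, ≤ 0 on Q}. Only finitely many
pairs (P, Q) exist, so one recurs along the sequence. In the limit Q ⊆ I₀(y) ∪ I_>(y) and P misses
I_>(y), and Farkas' lemma yields coefficients supported on Q and nonnegative off P.

Equality. Under linear independence the multipliers are continuous functions of the normal vector,
read off by a biorthogonal family. Hence every y in the domain of D*G is orthogonal to the x*ᵢ with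
lᵢ > 0. The base point is then approached by graph points whose active set is exactly I₀(y) ∪ I_>(y)
and whose positive multipliers are exactly those in I₀(y). There the explicit vectors are Fréchet
normals, and outer semicontinuity of the limiting normal cone concludes. -/

namespace Sweeping

/-! ### Farkas' lemma and normal cones of general sets -/

section Cones

variable {X : Type*} [NormedAddCommGroup X] [InnerProductSpace ℝ X]

/-- **Farkas' lemma** for finitely many vectors. -/
theorem exists_nonneg_combination {ι : Type*} (s : Finset ι) :
    ∀ (x : ι → X) (v : X),
      (∀ h, (∀ i ∈ s, inner ℝ (x i) h ≤ 0) → inner ℝ v h ≤ 0) →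
      ∃ l : ι → ℝ, (∀ i, 0 ≤ l i) ∧ v = ∑ i ∈ s, l i • x i := by
  classical
  induction s using Finset.induction_on with
  | empty =>
    intro x v hv
    refine ⟨0, fun _ => le_rfl, ?_⟩
    have := hv v (by simp)
    simpa using le_antisymm this real_inner_self_nonneg
  | insert a s ha ih =>
    intro x v hv
    by_cases hs : ∀ h, (∀ i ∈ s, inner ℝ (x i) h ≤ 0) → inner ℝ v h ≤ 0
    · obtain ⟨l, hl, hvl⟩ := ih x v hs
      refine ⟨Function.update l a 0, fun i => ?_, ?_⟩
      · by_cases hi : i = a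
        · simp [hi]
        · simpa [hi] using hl i
      · rw [Finset.sum_insert ha, hvl]
        simp only [Function.update_self, zero_smul, zero_add]
        refine Finset.sum_congr rfl fun i hi => ?_
        rw [Function.update_of_ne (ne_of_mem_of_not_mem hi ha)]
    · push Not at hs
      obtain ⟨h₀, hs₀, hv₀⟩ := hs
      have ha₀ : 0 < inner ℝ (x a) h₀ := by
        by_contra hcon
        refine hv₀.not_ge (hv h₀ fun i hi => ?_)
        rcases Finset.mem_insert.1 hi with rfl | hi
        · exact not_lt.1 hcon
        · exact hs₀ i hi
      set α := inner ℝ (x a) h₀ with hα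
      -- Induct on the oblique projections onto the orthogonal complement of `h₀` along `x a`; the
      -- adjoint projection sends every test vector into the complement of `x a`, so the constraint
      -- of `a` holds trivially.
      obtain ⟨l, hl, hvl⟩ := ih (fun i => x i - (inner ℝ (x i) h₀ / α) • x a)
        (v - (inner ℝ v h₀ / α) • x a) (by
          intro h hh
          have key : ∀ z : X, inner ℝ (z - (inner ℝ z h₀ / α) • x a) h =
              inner ℝ z (h - (inner ℝ (x a) h / α) • h₀) := by
            intro z
            simp only [inner_sub_left, inner_sub_right, real_inner_smul_left,
              real_inner_smul_right]
            ring
          rw [key]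
          refine hv _ fun i hi => ?_
          rcases Finset.mem_insert.1 hi with rfl | hi
          · simp only [inner_sub_right, real_inner_smul_right, ← hα]
            field_simp
            simp
          · rw [← key]
            exact hh i hi)
      have hc : 0 ≤ (inner ℝ v h₀ - ∑ i ∈ s, l i * inner ℝ (x i) h₀) / α := by
        refine div_nonneg (sub_nonneg.2 (le_trans ?_ hv₀.le)) ha₀.le
        exact Finset.sum_nonpos fun i hi => mul_nonpos_of_nonneg_of_nonpos (hl i) (hs₀ i hi)
      refine ⟨Function.update l a ((inner ℝ v h₀ - ∑ i ∈ s, l i * inner ℝ (x i) h₀) / α),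
        fun i => ?_, ?_⟩
      · by_cases hi : i = a
        · subst hi; simpa using hc
        · simpa [hi] using hl i
      · rw [Finset.sum_insert ha, Function.update_self]
        have e1 : ∑ i ∈ s, Function.update l a
            ((inner ℝ v h₀ - ∑ i ∈ s, l i * inner ℝ (x i) h₀) / α) i • x i =
            ∑ i ∈ s, l i • x i :=
          Finset.sum_congr rfl fun i hi => by
            rw [Function.update_of_ne (ne_of_mem_of_not_mem hi ha)]
        rw [e1]
        have e2 : ∑ i ∈ s, l i • (x i - (inner ℝ (x i) h₀ / α) • x a) =
            ∑ i ∈ s, l i • x i - ((∑ i ∈ s, l i * inner ℝ (x i) h₀) / α) • x a := by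
          simp only [smul_sub, Finset.sum_sub_distrib, smul_smul, Finset.sum_div,
            Finset.sum_smul, mul_div_assoc]
        rw [e2, sub_eq_iff_eq_add] at hvl
        refine hvl.trans ?_
        rw [sub_div, sub_smul]
        abel

/-- The vectors polar to every one-sided velocity at `p` of a curve that starts in `p` and
runs in `Ω`. -/
def curveNormalCone (Ω : Set X) (p : X) : Set X :=
  {ν | ∀ (c : ℝ → X) (c' : X), c 0 = p → HasDerivAt c c' 0 → (∀ᶠ t in 𝓝[>] (0 : ℝ), c t ∈ Ω) →
    inner ℝ ν c' ≤ 0}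

/-- Along such a curve the squared distance to `z` is minimal at t = 0, so its right derivative
there is nonnegative. -/
theorem sub_mem_curveNormalCone {Ω : Set X} {z p : X} (hp : p ∈ projSet Ω z) :
    z - p ∈ curveNormalCone Ω p := by
  intro c c' hc0 hc hΩ
  have hd : HasDerivAt (fun t => ‖z - c t‖ ^ 2) (2 * inner ℝ (z - c 0) (0 - c')) 0 :=
    ((hasDerivAt_const (0 : ℝ) z).sub hc).norm_sq
  have hs := (hasDerivAt_iff_tendsto_slope.1 hd).mono_left
    (nhdsWithin_mono (0 : ℝ) (fun t (ht : t ∈ Set.Ioi 0) => ne_of_gt ht))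
  have h0 : 0 ≤ 2 * inner ℝ (z - c 0) (0 - c') := by
    refine ge_of_tendsto hs ?_
    filter_upwards [hΩ, self_mem_nhdsWithin] with t ht (ht0 : 0 < t)
    rw [slope_def_field, hc0]
    refine div_nonneg (sub_nonneg.2 ?_) (by linarith)
    exact pow_le_pow_left₀ (norm_nonneg _) (hp.2 _ ht) 2
  rw [hc0, zero_sub, inner_neg_right] at h0
  linarith

theorem smul_mem_curveNormalCone {Ω : Set X} {p ν : X} {α : ℝ} (hα : 0 ≤ α)
    (hν : ν ∈ curveNormalCone Ω p) : α • ν ∈ curveNormalCone Ω p := by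
  intro c c' hc0 hc hΩ
  rw [real_inner_smul_left]
  exact mul_nonpos_of_nonneg_of_nonpos hα (hν c c' hc0 hc hΩ)

/-- A limiting normal is a limit of vectors polar to the curves in `Ω` at nearby points. -/
theorem exists_seq_of_mem_limitingNormalCone {Ω : Set X} {p v : X}
    (hv : v ∈ limitingNormalCone Ω p) :
    ∃ (q ν : ℕ → X), Tendsto q atTop (𝓝 p) ∧ Tendsto ν atTop (𝓝 v) ∧
      ∀ k, q k ∈ Ω ∧ ν k ∈ curveNormalCone Ω (q k) := by
  obtain ⟨hp, z, ν, hz, hν, hmem⟩ := hv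
  choose α hα s hs hνs using hmem
  choose q hq hqs using hs
  refine ⟨q, ν, ?_, hν, fun k => ⟨(hq k).1, ?_⟩⟩
  · have hzp : Tendsto (fun k => z k - p) atTop (𝓝 0) := by
      simpa using hz.sub_const p
    have hzq : Tendsto (fun k => z k - q k) atTop (𝓝 0) :=
      squeeze_zero_norm (fun k => (hq k).2 p hp) (by simpa using hzp.norm)
    simpa using hz.sub hzq
  · rw [hνs k, ← hqs k]
    exact smul_mem_curveNormalCone (hα k) (sub_mem_curveNormalCone (hq k))

/-- The limiting normal cone is outer semicontinuous. -/
theorem mem_limitingNormalCone_of_tendsto {Ω : Set X} {p v : X} {q ν : ℕ → X} (hp : p ∈ Ω)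
    (hq : Tendsto q atTop (𝓝 p)) (hν : Tendsto ν atTop (𝓝 v))
    (h : ∀ᶠ k in atTop, ν k ∈ limitingNormalCone Ω (q k)) : v ∈ limitingNormalCone Ω p := by
  -- An outer limit is a section of the closure of a graph, so taking it twice adds nothing.
  have key : ∀ {p v : X}, v ∈ outerLimit
      (fun x => coneHull ((fun p => x - p) '' projSet Ω x)) p ↔
      (p, v) ∈ closure {a : X × X | a.2 ∈ coneHull ((fun p => a.1 - p) '' projSet Ω a.1)} := by
    intro p v
    rw [mem_closure_iff_seq_limit]
    constructor
    · rintro ⟨xs, ys, hx, hy, hm⟩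
      exact ⟨fun k => (xs k, ys k), hm, hx.prodMk_nhds hy⟩
    · rintro ⟨a, hm, ha⟩
      exact ⟨fun k => (a k).1, fun k => (a k).2, (continuous_fst.tendsto _).comp ha,
        (continuous_snd.tendsto _).comp ha, hm⟩
  refine ⟨hp, key.2 (isClosed_closure.mem_of_tendsto (hq.prodMk_nhds hν) ?_)⟩
  filter_upwards [h] with k hk using key.1 hk.2

/-- In a proper space, regular (Fréchet) normals to a closed set are limiting normals. -/
theorem mem_limitingNormalCone_of_frechet [ProperSpace X] {Ω : Set X} (hΩ : IsClosed Ω) {p ν : X}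
    (hp : p ∈ Ω)
    (hν : ∀ ε > 0, ∀ᶠ q in 𝓝[Ω] p, inner ℝ ν (q - p) ≤ ε * ‖q - p‖) :
    ν ∈ limitingNormalCone Ω p := by
  have hproj : ∀ z : X, ∃ q, q ∈ projSet Ω z := by
    intro z
    obtain ⟨q, hq, hd⟩ := hΩ.exists_infDist_eq_dist ⟨p, hp⟩ z
    refine ⟨q, hq, fun r hr => ?_⟩
    rw [← dist_eq_norm, ← dist_eq_norm, ← hd]
    exact Metric.infDist_le_dist_of_mem hr
  choose π hπ using hproj
  -- Project p + tν onto Ω with t ↓ 0. The Fréchet inequality makes the projection q satisfy q - p =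
  -- o(t), so the proximal normals (p + tν - q)/t tend to ν.
  let t : ℕ → ℝ := fun k => 1 / ((k : ℝ) + 1)
  have ht : Tendsto t atTop (𝓝 0) := tendsto_one_div_add_atTop_nhds_zero_nat
  have ht0 : ∀ k, 0 < t k := fun k => by positivity
  let z : ℕ → X := fun k => p + t k • ν
  have hz : Tendsto z atTop (𝓝 p) := by
    simpa using (ht.smul_const ν).const_add p
  let q : ℕ → X := fun k => π (z k)
  have hqΩ : ∀ k, q k ∈ Ω := fun k => (hπ _).1
  have hq : Tendsto q atTop (𝓝 p) := by
    have hzp : Tendsto (fun k => z k - p) atTop (𝓝 0) := by simpa using hz.sub_const p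
    have hzq : Tendsto (fun k => z k - q k) atTop (𝓝 0) :=
      squeeze_zero_norm (fun k => (hπ (z k)).2 p hp) (by simpa using hzp.norm)
    simpa using hz.sub hzq
  have hqn : Tendsto q atTop (𝓝[Ω] p) :=
    tendsto_nhdsWithin_iff.2 ⟨hq, Eventually.of_forall hqΩ⟩
  -- The point `p` itself competes in the projection; expand the squares.
  have hsq : ∀ k, ‖q k - p‖ ^ 2 ≤ 2 * t k * inner ℝ ν (q k - p) := by
    intro k
    have h1 : ‖t k • ν - (q k - p)‖ ≤ ‖t k • ν‖ := by
      have := (hπ (z k)).2 p hp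
      convert this using 2 <;> simp only [z, q] <;> abel
    have h2 := pow_le_pow_left₀ (norm_nonneg _) h1 2
    rw [norm_sub_sq_real, real_inner_smul_left] at h2
    linarith
  have hlim : Tendsto (fun k => (t k)⁻¹ • (q k - p)) atTop (𝓝 0) := by
    rw [NormedAddGroup.tendsto_nhds_zero]
    intro ε hε
    filter_upwards [hqn.eventually (hν (ε / 4) (by positivity))] with k hk
    have h3 : ‖q k - p‖ * ‖q k - p‖ ≤ (t k * (ε / 2)) * ‖q k - p‖ := by
      nlinarith [hsq k, ht0 k, mul_le_mul_of_nonneg_left hk (ht0 k).le]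
    have h4 : ‖q k - p‖ ≤ t k * (ε / 2) := by
      rcases (norm_nonneg (q k - p)).eq_or_lt with h0 | h0
      · rw [← h0]; have := ht0 k; positivity
      · exact le_of_mul_le_mul_right h3 h0
    rw [norm_smul, norm_inv, Real.norm_of_nonneg (ht0 k).le, inv_mul_lt_iff₀ (ht0 k)]
    nlinarith [ht0 k]
  refine ⟨hp, z, fun k => (t k)⁻¹ • (z k - q k), hz, ?_, fun k => ?_⟩
  · have e : (fun k => (t k)⁻¹ • (z k - q k)) = fun k => ν - (t k)⁻¹ • (q k - p) := by
      funext k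
      have : z k - q k = t k • ν - (q k - p) := by simp only [z]; abel
      rw [this, smul_sub, smul_smul, inv_mul_cancel₀ (ht0 k).ne', one_smul]
    rw [e]
    simpa using hlim.const_sub ν
  · exact ⟨(t k)⁻¹, (inv_pos.2 (ht0 k)).le, _, ⟨q k, hπ _, rfl⟩, rfl⟩

/-- A finite linearly independent family has a biorthogonal one. -/
theorem exists_biorthogonal [FiniteDimensional ℝ X] {ι : Type*} [DecidableEq ι] {x : ι → X} {s : Set ι}
    (h : LinearIndepOn ℝ x s) :
    ∃ b : ι → X, ∀ i ∈ s, ∀ j ∈ s, inner ℝ (x j) (b i) = if j = i then 1 else 0 := by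
  classical
  have := FiniteDimensional.complete ℝ X
  -- A left inverse of the linear-combination map supplies coordinate functionals; Riesz
  -- representation turns them into vectors.
  obtain ⟨g, hg⟩ := LinearMap.exists_leftInverse_of_injective
    (Finsupp.linearCombination ℝ fun j : s => x j) (linearIndependent_iff_ker.1 h)
  have hgx : ∀ j : s, g (x j) = Finsupp.single j 1 := by
    intro j
    have := LinearMap.congr_fun hg (Finsupp.single j 1)
    simpa using this
  let φ : s → X →ₗ[ℝ] ℝ := fun i => Finsupp.lapply i ∘ₗ g
  refine ⟨fun i => if hi : i ∈ s then
    (InnerProductSpace.toDual ℝ X).symm (LinearMap.toContinuousLinearMap (φ ⟨i, hi⟩)) else 0,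
    fun i hi j hj => ?_⟩
  simp only [hi, dif_pos]
  rw [real_inner_comm, InnerProductSpace.toDual_symm_apply]
  simp [φ, hgx ⟨j, hj⟩, Finsupp.single_apply]

end Cones

/-! ### Normals of a polyhedron and their multipliers -/

section Polyhedra

variable {n m : ℕ} {xs : Fin m → Euc n}

@[simp]
theorem mem_activeIdx {x : Euc n} {i : Fin m} : i ∈ activeIdx xs x ↔ inner ℝ (xs i) x = 0 := by
  simp [activeIdx]

theorem isClosed_polyhedron : IsClosed (polyhedron xs) := by
  simp only [polyhedron, Set.ofPred_forall]
  exact isClosed_iInter fun i =>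
    isClosed_le (continuous_const.inner continuous_id) continuous_const

/-- Feasible directions of a polyhedron are those that are feasible for the active constraints. -/
theorem eventually_add_smul_mem_polyhedron {x h : Euc n} (hx : x ∈ polyhedron xs)
    (hh : ∀ i ∈ activeIdx xs x, inner ℝ (xs i) h ≤ 0) :
    ∀ᶠ t in 𝓝[>] (0 : ℝ), x + t • h ∈ polyhedron xs := by
  simp only [polyhedron, Set.mem_ofPred_eq, eventually_all]
  intro i
  rcases (hx i).eq_or_lt with hi | hi
  · filter_upwards [self_mem_nhdsWithin] with t (ht : 0 < t)
    rw [inner_add_right, hi, real_inner_smul_right, zero_add]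
    exact mul_nonpos_of_nonneg_of_nonpos ht.le (hh i (mem_activeIdx.2 hi))
  · have hc : Continuous fun t : ℝ => inner ℝ (xs i) (x + t • h) := by fun_prop
    have := (hc.tendsto 0).eventually_lt_const (u := 0) (by simpa using hi)
    exact (this.filter_mono nhdsWithin_le_nhds).mono fun t ht => ht.le

/-- Normals to a polyhedron are the nonnegative combinations of active constraint vectors. -/
theorem mem_convexNormalCone_polyhedron_iff {x v : Euc n} :
    v ∈ convexNormalCone (polyhedron xs) x ↔ x ∈ polyhedron xs ∧ ∃ l : Fin m → ℝ,
      (∀ i, 0 ≤ l i) ∧ (∀ i, l i ≠ 0 → inner ℝ (xs i) x = 0) ∧ v = ∑ i, l i • xs i := by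
  constructor
  · rintro ⟨hx, hv⟩
    refine ⟨hx, ?_⟩
    obtain ⟨l, hl, hvl⟩ := exists_nonneg_combination (activeIdx xs x) xs v (by
      intro h hh
      obtain ⟨t, ht, ht0⟩ := ((eventually_add_smul_mem_polyhedron hx hh).and
        self_mem_nhdsWithin).exists
      have := hv _ ht
      rw [add_sub_cancel_left, real_inner_smul_right] at this
      exact nonpos_of_mul_nonpos_right this ht0)
    refine ⟨fun i => if i ∈ activeIdx xs x then l i else 0, fun i => ?_, fun i hi => ?_, ?_⟩
    · dsimp only
      split_ifs
      exacts [hl i, le_rfl]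
    · by_contra hcon
      simp [hcon] at hi
    · rw [hvl]
      simp [ite_smul, Finset.sum_ite, activeIdx]
  · rintro ⟨hx, l, hl, hsupp, rfl⟩
    refine ⟨hx, fun c hc => ?_⟩
    rw [sum_inner]
    refine Finset.sum_nonpos fun i _ => ?_
    rw [real_inner_smul_left]
    by_cases hi : l i = 0
    · simp [hi]
    · refine mul_nonpos_of_nonneg_of_nonpos (hl i) ?_
      rw [inner_sub_right, hsupp i hi, sub_zero]
      exact hc i

theorem add_smul_mem_convexNormalCone {x v : Euc n} (hv : v ∈ convexNormalCone (polyhedron xs) x)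
    {i : Fin m} (hi : inner ℝ (xs i) x = 0) {t : ℝ} (ht : 0 ≤ t) :
    v + t • xs i ∈ convexNormalCone (polyhedron xs) x := by
  refine ⟨hv.1, fun c hc => ?_⟩
  rw [inner_add_left, real_inner_smul_left, inner_sub_right (xs i), hi, sub_zero]
  exact add_nonpos (hv.2 c hc) (mul_nonpos_of_nonneg_of_nonpos ht (hc i))

section Multipliers

variable {x : Euc n} {l : Fin m → ℝ} (hx : x ∈ polyhedron xs) (hl : ∀ i, 0 ≤ l i)
  (hsupp : ∀ i, l i ≠ 0 → inner ℝ (xs i) x = 0)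
include hx hl hsupp

theorem eventually_sub_smul_mem_convexNormalCone {i : Fin m} (hi : 0 < l i) :
    ∀ᶠ t in 𝓝[>] (0 : ℝ),
      ∑ j, l j • xs j - t • xs i ∈ convexNormalCone (polyhedron xs) x := by
  classical
  filter_upwards [Ioc_mem_nhdsGT hi] with t ht
  refine mem_convexNormalCone_polyhedron_iff.2 ⟨hx, fun j => l j - if j = i then t else 0,
    fun j => ?_, fun j hj => ?_, ?_⟩
  · dsimp only
    split_ifs with h
    · rw [h]; exact sub_nonneg.2 ht.2
    · simpa using hl j
  · by_cases h : j = i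
    · rw [h]; exact hsupp i hi.ne'
    · exact hsupp j (by simpa [h] using hj)
  · simp [sub_smul, ite_smul, Finset.sum_sub_distrib]

/-- Along such a direction the constraints with positive multipliers stay active, so the same normal
vector with the same multipliers remains normal. -/
theorem eventually_mem_convexNormalCone_add_smul {h : Euc n}
    (h0 : ∀ i, 0 < l i → inner ℝ (xs i) h = 0)
    (hh : ∀ i ∈ activeIdx xs x, inner ℝ (xs i) h ≤ 0) :
    ∀ᶠ t in 𝓝[>] (0 : ℝ),
      ∑ j, l j • xs j ∈ convexNormalCone (polyhedron xs) (x + t • h) := by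
  filter_upwards [eventually_add_smul_mem_polyhedron hx hh] with t ht
  refine mem_convexNormalCone_polyhedron_iff.2 ⟨ht, l, hl, fun i hi => ?_, rfl⟩
  rw [inner_add_right, real_inner_smul_right, hsupp i hi,
    h0 i (lt_of_le_of_ne (hl i) (Ne.symm hi))]
  simp

end Multipliers

/-- The graph of the normal cone mapping of a closed set is closed. -/
theorem isClosed_graph_convexNormalCone {C : Set (Euc n)} (hC : IsClosed C) :
    IsClosed {p : Euc n × Euc n | p.2 ∈ convexNormalCone C p.1} := by
  have : {p : Euc n × Euc n | p.2 ∈ convexNormalCone C p.1} =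
      {p | p.1 ∈ C} ∩ ⋂ c ∈ C, {p | inner ℝ p.2 (c - p.1) ≤ 0} := by
    ext p
    simp [convexNormalCone]
  rw [this]
  exact (hC.preimage continuous_fst).inter (isClosed_biInter fun c _ =>
    isClosed_le (by fun_prop) continuous_const)

/-- Multiplier of a normal vector, read off with a biorthogonal family. -/
theorem inner_sum_smul_biorthogonal {s : Set (Fin m)} {b : Fin m → Euc n}
    (hb : ∀ i ∈ s, ∀ j ∈ s, inner ℝ (xs j) (b i) = if j = i then 1 else 0)
    {l : Fin m → ℝ} (hls : ∀ i, l i ≠ 0 → i ∈ s) {i : Fin m} (hi : i ∈ s) :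
    inner ℝ (∑ j, l j • xs j) (b i) = l i := by
  rw [sum_inner, Finset.sum_eq_single i]
  · rw [real_inner_smul_left, hb i hi i hi, if_pos rfl, mul_one]
  · intro j _ hji
    rw [real_inner_smul_left]
    by_cases hj : l j = 0
    · simp [hj]
    · rw [hb i hi j (hls j hj), if_neg hji, mul_zero]
  · simp

end Polyhedra

theorem hasDerivAt_toLp {E F : Type*} [NormedAddCommGroup E] [NormedSpace ℝ E]
    [NormedAddCommGroup F] [NormedSpace ℝ F] {c : ℝ → E} {e : ℝ → F} {c' : E} {e' : F} {t : ℝ}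
    (hc : HasDerivAt c c' t) (he : HasDerivAt e e' t) :
    HasDerivAt (fun t => WithLp.toLp 2 (c t, e t)) (WithLp.toLp 2 (c', e')) t :=
  (WithLp.prodContinuousLinearEquiv 2 ℝ E F).symm.hasFDerivAt.comp_hasDerivAt t (hc.prodMk he)

/-! ### The derivative of f and curves in the graph of F -/

section Graph

variable {n m d : ℕ} {xs : Fin m → Euc n} {f : Euc n → Euc d → Euc n}

/-- The derivative of `(x, a) ↦ f (x, a)`. -/
noncomputable def totalDeriv (f : Euc n → Euc d → Euc n) (x : Euc n) (a : Euc d) :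
    Euc n × Euc d →L[ℝ] Euc n :=
  fderiv ℝ (fun p : Euc n × Euc d => f p.1 p.2) (x, a)

theorem hasFDerivAt_totalDeriv (hf : ContDiff ℝ 1 (fun p : Euc n × Euc d => f p.1 p.2))
    (x : Euc n) (a : Euc d) :
    HasFDerivAt (fun p : Euc n × Euc d => f p.1 p.2) (totalDeriv f x a) (x, a) :=
  (hf.differentiable one_ne_zero (x, a)).hasFDerivAt

theorem gradXAdj_eq (hf : ContDiff ℝ 1 (fun p : Euc n × Euc d => f p.1 p.2))
    (x : Euc n) (a : Euc d) (y : Euc n) :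
    gradXAdj f x a y = ContinuousLinearMap.adjoint
      ((totalDeriv f x a).comp (ContinuousLinearMap.inl ℝ (Euc n) (Euc d))) y := by
  have h : HasFDerivAt (fun x' => f x' a) _ x := HasFDerivAt.comp (g := fun p : Euc n × Euc d => f p.1 p.2)
    (f := fun x' => (x', a)) x (hasFDerivAt_totalDeriv hf x a) (hasFDerivAt_prodMk_left x a)
  rw [gradXAdj, h.fderiv]

theorem gradAAdj_eq (hf : ContDiff ℝ 1 (fun p : Euc n × Euc d => f p.1 p.2))
    (x : Euc n) (a : Euc d) (y : Euc n) :
    gradAAdj f x a y = ContinuousLinearMap.adjoint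
      ((totalDeriv f x a).comp (ContinuousLinearMap.inr ℝ (Euc n) (Euc d))) y := by
  have h : HasFDerivAt (fun a' => f x a') _ a := HasFDerivAt.comp (g := fun p : Euc n × Euc d => f p.1 p.2)
    (f := fun a' => (x, a')) a (hasFDerivAt_totalDeriv hf x a) (hasFDerivAt_prodMk_right x a)
  rw [gradAAdj, h.fderiv]

theorem inner_gradXAdj (hf : ContDiff ℝ 1 (fun p : Euc n × Euc d => f p.1 p.2))
    (x : Euc n) (a : Euc d) (y h : Euc n) :
    inner ℝ (gradXAdj f x a y) h = inner ℝ y (totalDeriv f x a (h, 0)) := by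
  rw [gradXAdj_eq hf, ContinuousLinearMap.adjoint_inner_left]
  rfl

theorem inner_gradAAdj (hf : ContDiff ℝ 1 (fun p : Euc n × Euc d => f p.1 p.2))
    (x : Euc n) (a : Euc d) (y : Euc n) (h : Euc d) :
    inner ℝ (gradAAdj f x a y) h = inner ℝ y (totalDeriv f x a (0, h)) := by
  rw [gradAAdj_eq hf, ContinuousLinearMap.adjoint_inner_left]
  rfl

theorem continuous_totalDeriv (hf : ContDiff ℝ 1 (fun p : Euc n × Euc d => f p.1 p.2)) :
    Continuous fun p : Euc n × Euc d => totalDeriv f p.1 p.2 :=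
  hf.continuous_fderiv one_ne_zero

theorem continuous_gradXAdj (hf : ContDiff ℝ 1 (fun p : Euc n × Euc d => f p.1 p.2))
    (a : Euc d) (y : Euc n) : Continuous fun x => gradXAdj f x a y := by
  simp only [gradXAdj_eq hf]
  exact (ContinuousLinearMap.adjoint.continuous.comp (((continuous_totalDeriv hf).comp
    (Continuous.prodMk_left a)).clm_comp continuous_const)).clm_apply continuous_const

theorem continuous_gradAAdj (hf : ContDiff ℝ 1 (fun p : Euc n × Euc d => f p.1 p.2))
    (a : Euc d) (y : Euc n) : Continuous fun x => gradAAdj f x a y := by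
  simp only [gradAAdj_eq hf]
  exact (ContinuousLinearMap.adjoint.continuous.comp (((continuous_totalDeriv hf).comp
    (Continuous.prodMk_left a)).clm_comp continuous_const)).clm_apply continuous_const

theorem mem_graph_sweepingMap_iff {q : WithLp 2 (Triple n d × Euc n)} :
    q ∈ graph (sweepingMap xs f) ↔
      q.snd - f q.fst.fst q.fst.snd.snd ∈
        convexNormalCone (polyhedron xs) (q.fst.fst - q.fst.snd.fst) := by
  constructor
  · rintro ⟨v, hv, hq⟩
    rw [hq, add_sub_cancel_right]
    exact hv
  · intro h
    exact ⟨_, h, (sub_add_cancel _ _).symm⟩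

/-- Movements of the parameters and of the normal vector give curves in the graph of the
sweeping mapping. -/
theorem inner_le_of_mem_curveNormalCone
    (hf : ContDiff ℝ 1 (fun p : Euc n × Euc d => f p.1 p.2))
    {q ν : WithLp 2 (Triple n d × Euc n)} (hν : ν ∈ curveNormalCone (graph (sweepingMap xs f)) q)
    {h₁ h₂ s : Euc n} {h₃ : Euc d}
    (hs : ∀ᶠ t in 𝓝[>] (0 : ℝ), q.snd - f q.fst.fst q.fst.snd.snd + t • s ∈
      convexNormalCone (polyhedron xs) (q.fst.fst - q.fst.snd.fst + t • (h₁ - h₂))) :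
    inner ℝ ν.fst.fst h₁ + inner ℝ ν.fst.snd.fst h₂ + inner ℝ ν.fst.snd.snd h₃ +
      inner ℝ ν.snd (totalDeriv f q.fst.fst q.fst.snd.snd (h₁, h₃) + s) ≤ 0 := by
  set x := q.fst.fst
  set u := q.fst.snd.fst
  set a := q.fst.snd.snd
  have line : ∀ {E : Type} [NormedAddCommGroup E] [NormedSpace ℝ E] (z h : E),
      HasDerivAt (fun t : ℝ => z + t • h) h 0 := by
    intro E _ _ z h
    simpa using ((hasDerivAt_id (0 : ℝ)).smul_const h).const_add z
  have hD : HasFDerivAt (fun p : Euc n × Euc d => f p.1 p.2) (totalDeriv f x a)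
      (x + (0 : ℝ) • h₁, a + (0 : ℝ) • h₃) := by
    simp only [zero_smul, add_zero]
    exact hasFDerivAt_totalDeriv hf x a
  have hfc : HasDerivAt (fun t : ℝ => f (x + t • h₁) (a + t • h₃))
      (totalDeriv f x a (h₁, h₃)) 0 :=
    HasFDerivAt.comp_hasDerivAt (l := fun p : Euc n × Euc d => f p.1 p.2)
      (f := fun t : ℝ => (x + t • h₁, a + t • h₃)) (0 : ℝ) hD ((line x h₁).prodMk (line a h₃))
  -- The last component absorbs the change of f, so that w - f(x,a) moves along the straight line
  -- with velocity `s`.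
  have hc := hν (fun t => WithLp.toLp 2 (triple (x + t • h₁) (u + t • h₂) (a + t • h₃),
      (q.snd - f x a + t • s) + f (x + t • h₁) (a + t • h₃))) _ (by
        simp only [zero_smul, add_zero, sub_add_cancel]
        rfl)
    (hasDerivAt_toLp (hasDerivAt_toLp (line x h₁) (hasDerivAt_toLp (line u h₂) (line a h₃)))
      ((line (q.snd - f x a) s).add hfc)) (by
      filter_upwards [hs] with t ht
      refine mem_graph_sweepingMap_iff.2 ?_
      convert ht using 1
      · congr 1
        change x + t • h₁ - (u + t • h₂) = _
        rw [smul_sub]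
        abel
      · simp [triple])
  simp only [WithLp.prod_inner_apply] at hc
  rw [add_comm _ s, add_assoc (inner ℝ ν.fst.fst h₁)]
  exact hc

/-- The conditions satisfied by the normals of the graph at a point with multipliers `l`. -/
theorem conditions_of_mem_curveNormalCone
    (hf : ContDiff ℝ 1 (fun p : Euc n × Euc d => f p.1 p.2))
    {q ν : WithLp 2 (Triple n d × Euc n)} (hν : ν ∈ curveNormalCone (graph (sweepingMap xs f)) q)
    (hx : q.fst.fst - q.fst.snd.fst ∈ polyhedron xs)
    {l : Fin m → ℝ} (hl : ∀ i, 0 ≤ l i)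
    (hsupp : ∀ i, l i ≠ 0 → inner ℝ (xs i) (q.fst.fst - q.fst.snd.fst) = 0)
    (hv : q.snd - f q.fst.fst q.fst.snd.snd = ∑ i, l i • xs i) :
    (∀ h k, inner ℝ (ν.fst.fst + ν.fst.snd.fst) h + inner ℝ ν.fst.snd.snd k +
      inner ℝ ν.snd (totalDeriv f q.fst.fst q.fst.snd.snd (h, k)) = 0) ∧
    (∀ i ∈ activeIdx xs (q.fst.fst - q.fst.snd.fst), inner ℝ (xs i) ν.snd ≤ 0) ∧
    (∀ i, 0 < l i → 0 ≤ inner ℝ (xs i) ν.snd) ∧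
    (∀ h, (∀ i, 0 < l i → inner ℝ (xs i) h = 0) →
      (∀ i ∈ activeIdx xs (q.fst.fst - q.fst.snd.fst), inner ℝ (xs i) h ≤ 0) →
      inner ℝ (-ν.fst.snd.fst) h ≤ 0) := by
  have hvN : q.snd - f q.fst.fst q.fst.snd.snd ∈
      convexNormalCone (polyhedron xs) (q.fst.fst - q.fst.snd.fst) :=
    mem_convexNormalCone_polyhedron_iff.2 ⟨hx, l, hl, hsupp, hv⟩
  -- Equal velocities of x and u leave x - u and the normal vector unchanged; replacing (h, k) by
  -- its negative then gives equality.
  have hle : ∀ h k, inner ℝ (ν.fst.fst + ν.fst.snd.fst) h + inner ℝ ν.fst.snd.snd k +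
      inner ℝ ν.snd (totalDeriv f q.fst.fst q.fst.snd.snd (h, k)) ≤ 0 := by
    intro h k
    have := inner_le_of_mem_curveNormalCone hf hν (h₁ := h) (h₂ := h) (h₃ := k) (s := 0)
      (Eventually.of_forall fun _ => by simpa using hvN)
    rwa [add_zero, ← inner_add_left] at this
  refine ⟨fun h k => le_antisymm (hle h k) ?_, fun i hi => ?_, fun i hi => ?_, fun h h0 hh => ?_⟩
  · have := hle (-h) (-k)
    rw [← Prod.neg_mk, map_neg, inner_neg_right, inner_neg_right, inner_neg_right] at this
    linarith
  · have := inner_le_of_mem_curveNormalCone hf hν (h₁ := 0) (h₂ := 0) (h₃ := 0) (s := xs i) (by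
      filter_upwards [self_mem_nhdsWithin] with t (ht : 0 < t)
      simpa using add_smul_mem_convexNormalCone hvN (mem_activeIdx.1 hi) ht.le)
    rw [Prod.mk_zero_zero, map_zero] at this
    rw [real_inner_comm]
    simpa using this
  · have := inner_le_of_mem_curveNormalCone hf hν (h₁ := 0) (h₂ := 0) (h₃ := 0) (s := -xs i) (by
      rw [hv]
      simpa [sub_eq_add_neg] using eventually_sub_smul_mem_convexNormalCone hx hl hsupp hi)
    rw [Prod.mk_zero_zero, map_zero] at this
    rw [real_inner_comm]
    simpa using this
  · have := inner_le_of_mem_curveNormalCone hf hν (h₁ := 0) (h₂ := -h) (h₃ := 0) (s := 0) (by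
      rw [hv]
      simpa using eventually_mem_convexNormalCone_add_smul hx hl hsupp h0 hh)
    rw [Prod.mk_zero_zero, map_zero] at this
    simpa using this

end Graph

/-- Multipliers of a vector polar to the cone `⟨xᵢ, h⟩ = 0` on `P`, `⟨xᵢ, h⟩ ≤ 0` on `Q`. -/
theorem exists_combination_of_polar {X : Type*} [NormedAddCommGroup X] [InnerProductSpace ℝ X]
    {ι : Type*} [DecidableEq ι] (P Q : Finset ι) (hPQ : P ⊆ Q) (x : ι → X) (v : X)
    (hv : ∀ h, (∀ i ∈ P, inner ℝ (x i) h = 0) → (∀ i ∈ Q, inner ℝ (x i) h ≤ 0) →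
      inner ℝ v h ≤ 0) :
    ∃ γ : ι → ℝ, (∀ i ∉ P, 0 ≤ γ i) ∧ (∀ i ∉ Q, γ i = 0) ∧ v = ∑ i ∈ Q, γ i • x i := by
  -- An equality on `P` is encoded by adjoining the opposite vectors -xᵢ to the inequalities on `Q`;
  -- the two multipliers of such an index subtract to a coefficient of free sign.
  obtain ⟨l, hl, hvl⟩ := exists_nonneg_combination (Q.disjSum P)
    (Sum.elim x fun i => -x i) v (by
      intro h hh
      refine hv h (fun i hi => ?_) fun i hi => hh (Sum.inl i) (by simpa using hi)
      have h1 := hh (Sum.inl i) (by simpa using hPQ hi)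
      have h2 := hh (Sum.inr i) (by simpa using hi)
      simp only [Sum.elim_inl, Sum.elim_inr, inner_neg_left] at h1 h2
      linarith)
  refine ⟨fun i => (if i ∈ Q then l (Sum.inl i) else 0) - if i ∈ P then l (Sum.inr i) else 0,
    fun i hi => ?_, fun i hi => ?_, ?_⟩
  · simp only [hi, if_false, sub_zero]
    split_ifs
    exacts [hl _, le_rfl]
  · simp [hi, show i ∉ P from fun h => hi (hPQ h)]
  · rw [hvl, Finset.sum_disjSum]
    simp only [Sum.elim_inl, Sum.elim_inr, sub_smul, Finset.sum_sub_distrib, ite_smul, zero_smul,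
      smul_neg, Finset.sum_neg_distrib, Finset.sum_ite_mem, Finset.inter_self,
      Finset.inter_eq_right.2 hPQ]
    abel

theorem continuous_withLp_fst {E F : Type*} [NormedAddCommGroup E] [NormedSpace ℝ E]
    [NormedAddCommGroup F] [NormedSpace ℝ F] : Continuous fun q : WithLp 2 (E × F) => q.fst :=
  (WithLp.fstL 2 ℝ E F).continuous

theorem continuous_withLp_snd {E F : Type*} [NormedAddCommGroup E] [NormedSpace ℝ E]
    [NormedAddCommGroup F] [NormedSpace ℝ F] : Continuous fun q : WithLp 2 (E × F) => q.snd :=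
  (WithLp.sndL 2 ℝ E F).continuous

section Components

variable {n d : ℕ} {ι : Type*} {l : Filter ι} {q : ι → WithLp 2 (Triple n d × Euc n)}
  {p : WithLp 2 (Triple n d × Euc n)}

theorem tendsto_components (hq : Tendsto q l (𝓝 p)) :
    Tendsto (fun k => (q k).fst.fst) l (𝓝 p.fst.fst) ∧
    Tendsto (fun k => (q k).fst.snd.fst) l (𝓝 p.fst.snd.fst) ∧
    Tendsto (fun k => (q k).fst.snd.snd) l (𝓝 p.fst.snd.snd) ∧
    Tendsto (fun k => (q k).snd) l (𝓝 p.snd) := by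
  have h1 : Tendsto (fun k => (q k).fst) l (𝓝 p.fst) := (continuous_withLp_fst.tendsto p).comp hq
  have h2 : Tendsto (fun k => (q k).fst.snd) l (𝓝 p.fst.snd) :=
    (continuous_withLp_snd.tendsto p.fst).comp h1
  exact ⟨(continuous_withLp_fst.tendsto p.fst).comp h1,
    (continuous_withLp_fst.tendsto p.fst.snd).comp h2,
    (continuous_withLp_snd.tendsto p.fst.snd).comp h2, (continuous_withLp_snd.tendsto p).comp hq⟩

end Components

/-! ### The upper estimate -/

section Upper

variable {n m d : ℕ} {xs : Fin m → Euc n} {f : Euc n → Euc d → Euc n}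

/-- The upper estimate of the coderivative, valid without constraint qualification. -/
theorem coderivative_sweepingMap_subset
    (hf : ContDiff ℝ 1 (fun p : Euc n × Euc d => f p.1 p.2))
    (x u : Euc n) (a : Euc d) (w y : Euc n) :
    coderivative (sweepingMap xs f) (triple x u a) w y ⊆ explicitSet xs f x u a y := by
  classical
  intro ξ hξ
  obtain ⟨q, ν, hq, hν, hmem⟩ := exists_seq_of_mem_limitingNormalCone hξ
  have hN := fun k => mem_convexNormalCone_polyhedron_iff.1
    (mem_graph_sweepingMap_iff.1 (hmem k).1)
  choose hx l hl hsupp hv using hN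
  have hcond := fun k =>
    conditions_of_mem_curveNormalCone hf (hmem k).2 (hx k) (hl k) (hsupp k) (hv k)
  obtain ⟨hqx, hqu, hqa, -⟩ := tendsto_components hq
  obtain ⟨hνx, hνu, hνa, hνy⟩ := tendsto_components hν
  change Tendsto _ _ (𝓝 x) at hqx
  change Tendsto _ _ (𝓝 u) at hqu
  change Tendsto _ _ (𝓝 a) at hqa
  change Tendsto _ _ (𝓝 ξ.fst) at hνx
  change Tendsto _ _ (𝓝 ξ.snd.fst) at hνu
  change Tendsto _ _ (𝓝 ξ.snd.snd) at hνa
  change Tendsto _ _ (𝓝 (-y)) at hνy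
  -- the smooth part
  have hsm : ∀ h k, inner ℝ (ξ.fst + ξ.snd.fst) h + inner ℝ ξ.snd.snd k =
      inner ℝ y (totalDeriv f x a (h, k)) := by
    intro h k
    have hD : Tendsto (fun j => totalDeriv f (q j).fst.fst (q j).fst.snd.snd (h, k)) atTop
        (𝓝 (totalDeriv f x a (h, k))) :=
      ((((continuous_totalDeriv hf).clm_apply continuous_const).tendsto (x, a)).comp
        (hqx.prodMk_nhds hqa))
    have ht := (((hνx.add hνu).inner (𝕜 := ℝ) (tendsto_const_nhds (x := h))).add
      (hνa.inner (𝕜 := ℝ) (tendsto_const_nhds (x := k)))).add (hνy.inner (𝕜 := ℝ) hD)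
    have h0 := tendsto_nhds_unique (ht.congr fun j => (hcond j).1 h k) tendsto_const_nhds
    rw [inner_neg_left] at h0
    linarith
  -- a pair of index sets that occurs infinitely often
  obtain ⟨⟨P, Q⟩, hPQ⟩ : ∃ PQ : Finset (Fin m) × Finset (Fin m), ∃ᶠ k in atTop,
      (({i | 0 < l k i} : Finset (Fin m)),
        activeIdx xs ((q k).fst.fst - (q k).fst.snd.fst)) = PQ := by
    by_contra! hcon
    obtain ⟨k, hk⟩ := (eventually_all.2 hcon).exists
    exact hk _ rfl
  have hPk : ∃ᶠ k in atTop, (∀ i, 0 < l k i ↔ i ∈ P) ∧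
      activeIdx xs ((q k).fst.fst - (q k).fst.snd.fst) = Q := by
    refine hPQ.mono fun k hk => ?_
    obtain ⟨h1, h2⟩ := Prod.mk.inj hk
    exact ⟨fun i => by rw [← h1]; simp, h2⟩
  have hsub : P ⊆ Q := by
    obtain ⟨k, h1, h2⟩ := hPk.exists
    intro i hi
    rw [← h2, mem_activeIdx]
    exact hsupp k i ((h1 i).2 hi).ne'
  have hQact : ∀ i ∈ Q, i ∈ activeIdx xs (x - u) := by
    intro i hi
    have ht := (tendsto_const_nhds (x := xs i)).inner (𝕜 := ℝ) (hqx.sub hqu)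
    refine mem_activeIdx.2 (isClosed_singleton.mem_of_frequently_of_tendsto
      (hPk.mono fun k hk => ?_) ht)
    exact mem_activeIdx.1 (hk.2 ▸ hi)
  have hty : ∀ i, Tendsto (fun k => inner ℝ (xs i) (ν k).snd) atTop (𝓝 (inner ℝ (xs i) (-y))) :=
    fun i => tendsto_const_nhds.inner hνy
  have hQy : ∀ i ∈ Q, 0 ≤ inner ℝ (xs i) y := by
    intro i hi
    have := isClosed_Iic.mem_of_frequently_of_tendsto (hPk.mono fun k hk =>
      (hcond k).2.1 i (hk.2.symm ▸ hi)) (hty i)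
    rw [Set.mem_Iic, inner_neg_right] at this
    linarith
  have hPy : ∀ i ∈ P, inner ℝ (xs i) y = 0 := by
    intro i hi
    have := isClosed_Ici.mem_of_frequently_of_tendsto (hPk.mono fun k hk =>
      (hcond k).2.2.1 i ((hk.1 i).2 hi)) (hty i)
    rw [Set.mem_Ici, inner_neg_right] at this
    exact le_antisymm (by linarith) (hQy i (hsub hi))
  obtain ⟨γ, hγP, hγQ, hγ⟩ := exists_combination_of_polar P Q hsub xs (-ξ.snd.fst) (by
    intro h h0 hh
    have ht := hνu.neg.inner (𝕜 := ℝ) (tendsto_const_nhds (x := h))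
    refine isClosed_Iic.mem_of_frequently_of_tendsto (hPk.mono fun k hk => ?_) ht
    exact (hcond k).2.2.2 h (fun i hi => h0 i ((hk.1 i).1 hi)) (hk.2.symm ▸ hh))
  have hQsub : Q ⊆ idxZero xs (x - u) y ∪ idxPos xs (x - u) y := by
    intro i hi
    have h1 := mem_activeIdx.1 (hQact i hi)
    rcases (hQy i hi).eq_or_lt with h | h
    · simp [idxZero, h1, h.symm]
    · simp [idxPos, h1, h]
  have hsum : ∑ i ∈ idxZero xs (x - u) y ∪ idxPos xs (x - u) y, γ i • xs i = -ξ.snd.fst := by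
    rw [hγ]
    exact (Finset.sum_subset hQsub fun i _ hi => by rw [hγQ i hi, zero_smul]).symm
  -- An index of I_>(y) cannot lie in `P`, where ⟨x*ᵢ, y⟩ = 0, so its coefficient is nonnegative.
  refine ⟨γ, fun i hi => hγP i fun hiP => ?_, ?_⟩
  · have h1 := hPy i hiP
    simp [idxPos, h1] at hi
  · have e1 : gradXAdj f x a y = ξ.fst + ξ.snd.fst := by
      refine ext_inner_right ℝ fun h => ?_
      rw [inner_gradXAdj hf, ← hsm, inner_zero_right, add_zero]
    have e2 : gradAAdj f x a y = ξ.snd.snd := by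
      refine ext_inner_right ℝ fun h => ?_
      rw [inner_gradAAdj hf, ← hsm, inner_zero_right, zero_add]
    rw [hsum, e1, e2, neg_neg, add_neg_cancel_right]
    rfl

end Upper

/-! ### Equality under linear independence -/

section Lower

variable {n m d : ℕ} {xs : Fin m → Euc n} {f : Euc n → Euc d → Euc n}

theorem eventually_activeIdx_subset (x : Euc n) :
    ∀ᶠ z in 𝓝 x, activeIdx xs z ⊆ activeIdx xs x := by
  have h : ∀ i, ∀ᶠ z in 𝓝 x, inner ℝ (xs i) z = 0 → inner ℝ (xs i) x = 0 := by
    intro i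
    by_cases hi : inner ℝ (xs i) x = 0
    · exact Eventually.of_forall fun _ _ => hi
    · have hc : Continuous fun z : Euc n => inner ℝ (xs i) z := by fun_prop
      exact (hc.continuousAt.eventually_ne hi).mono fun z hz h0 => absurd h0 hz
  filter_upwards [eventually_all.2 h] with z hz i hi
  exact mem_activeIdx.2 (hz i (mem_activeIdx.1 hi))

/-- Under linear independence of the active constraints, positive multipliers stay positive. -/
theorem eventually_multipliers_pos {x : Euc n} {b : Fin m → Euc n}
    (hb : ∀ i ∈ activeIdx xs x, ∀ j ∈ activeIdx xs x,
      inner ℝ (xs j) (b i) = if j = i then 1 else 0)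
    {l : Fin m → ℝ} (hsupp : ∀ i, l i ≠ 0 → inner ℝ (xs i) x = 0)
    {ι : Type*} {F : Filter ι} {z v : ι → Euc n} (hz : Tendsto z F (𝓝 x))
    (hv : Tendsto v F (𝓝 (∑ i, l i • xs i))) :
    ∀ᶠ k in F, ∀ l' : Fin m → ℝ, (∀ i, l' i ≠ 0 → inner ℝ (xs i) (z k) = 0) →
      v k = ∑ i, l' i • xs i → ∀ i, 0 < l i → 0 < l' i := by
  have hpos : ∀ i, ∀ᶠ k in F, 0 < l i → 0 < inner ℝ (v k) (b i) := by
    intro i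
    by_cases hi : 0 < l i
    · have hlim := hv.inner (𝕜 := ℝ) (tendsto_const_nhds (x := b i))
      rw [inner_sum_smul_biorthogonal (s := (activeIdx xs x : Set (Fin m))) hb
        (fun j hj => mem_activeIdx.2 (hsupp j hj)) (mem_activeIdx.2 (hsupp i hi.ne'))] at hlim
      exact (hlim.eventually_const_lt hi).mono fun _ h _ => h
    · exact Eventually.of_forall fun _ h => absurd h hi
  filter_upwards [eventually_all.2 hpos, hz.eventually (eventually_activeIdx_subset (xs := xs) x)]
    with k hk hsub l' hl' hvk i hi
  have := hk i hi
  rwa [hvk, inner_sum_smul_biorthogonal (s := (activeIdx xs x : Set (Fin m))) hb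
    (fun j hj => hsub (mem_activeIdx.2 (hl' j hj))) (mem_activeIdx.2 (hsupp i hi.ne'))] at this

/-- Elements of the domain of the coderivative of the normal cone mapping are orthogonal to the
strongly active constraint vectors. -/
theorem inner_eq_zero_of_mem_coderivativeDom {x : Euc n} {b : Fin m → Euc n}
    (hb : ∀ i ∈ activeIdx xs x, ∀ j ∈ activeIdx xs x,
      inner ℝ (xs j) (b i) = if j = i then 1 else 0)
    {l : Fin m → ℝ} (hsupp : ∀ i, l i ≠ 0 → inner ℝ (xs i) x = 0)
    {y : Euc n} (hy : y ∈ coderivativeDom (normalMap xs) x (∑ i, l i • xs i))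
    {i : Fin m} (hi : 0 < l i) : inner ℝ (xs i) y = 0 := by
  obtain ⟨ξ, hξ⟩ := hy
  obtain ⟨q, ν, hq, hν, hmem⟩ := exists_seq_of_mem_limitingNormalCone hξ
  have hqx : Tendsto (fun k => (q k).fst) atTop (𝓝 x) :=
    (continuous_withLp_fst.tendsto _).comp hq
  have hqv : Tendsto (fun k => (q k).snd) atTop (𝓝 (∑ i, l i • xs i)) :=
    (continuous_withLp_snd.tendsto _).comp hq
  have hνy : Tendsto (fun k => (ν k).snd) atTop (𝓝 (-y)) :=
    (continuous_withLp_snd.tendsto _).comp hν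
  -- The i-th multiplier stays positive nearby, so the normal vector can move along both x*ᵢ and its
  -- opposite.
  have hzero : ∀ᶠ k in atTop, inner ℝ (xs i) (ν k).snd = 0 := by
    filter_upwards [eventually_multipliers_pos hb hsupp hqx hqv] with k hk
    have hN : (q k).snd ∈ convexNormalCone (polyhedron xs) (q k).fst := (hmem k).1
    obtain ⟨hx, l', hl', hsupp', hv'⟩ := mem_convexNormalCone_polyhedron_iff.1 hN
    have hli : 0 < l' i := hk l' hsupp' hv' i hi
    have hcurve : ∀ s : Euc n, (∀ᶠ t in 𝓝[>] (0 : ℝ),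
        (q k).snd + t • s ∈ convexNormalCone (polyhedron xs) (q k).fst) →
        inner ℝ (ν k).snd s ≤ 0 := by
      intro s hs
      have hd : HasDerivAt (fun t : ℝ => (q k).snd + t • s) s 0 := by
        simpa using ((hasDerivAt_id (0 : ℝ)).smul_const s).const_add (q k).snd
      have := (hmem k).2 (fun t => WithLp.toLp 2 ((q k).fst, (q k).snd + t • s)) _
        (by simp only [zero_smul, add_zero]; rfl)
        (hasDerivAt_toLp (hasDerivAt_const (0 : ℝ) (q k).fst) hd) hs
      simpa [WithLp.prod_inner_apply] using this
    have h1 := hcurve (xs i) (by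
      filter_upwards [self_mem_nhdsWithin] with t (ht : 0 < t)
      exact add_smul_mem_convexNormalCone hN (hsupp' i hli.ne') ht.le)
    have h2 := hcurve (-xs i) (by
      rw [hv']
      simpa [sub_eq_add_neg] using eventually_sub_smul_mem_convexNormalCone hx hl' hsupp' hli)
    rw [inner_neg_right] at h2
    rw [real_inner_comm]
    linarith
  have hlim := (tendsto_const_nhds (x := xs i)).inner (𝕜 := ℝ) hνy
  have := tendsto_nhds_unique hlim (tendsto_const_nhds.congr' (hzero.mono fun _ h => h.symm))
  rwa [inner_neg_right, neg_eq_zero] at this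

theorem isClosed_graph_sweepingMap
    (hf : ContDiff ℝ 1 (fun p : Euc n × Euc d => f p.1 p.2)) :
    IsClosed (graph (sweepingMap xs f)) := by
  have e : graph (sweepingMap xs f) = (fun q : WithLp 2 (Triple n d × Euc n) =>
      (q.fst.fst - q.fst.snd.fst, q.snd - f q.fst.fst q.fst.snd.snd)) ⁻¹'
      {p : Euc n × Euc n | p.2 ∈ convexNormalCone (polyhedron xs) p.1} := by
    ext q
    exact mem_graph_sweepingMap_iff
  rw [e]
  refine (isClosed_graph_convexNormalCone isClosed_polyhedron).preimage ?_
  refine continuous_iff_continuousAt.2 fun q => ?_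
  obtain ⟨h1, h2, h3, h4⟩ := tendsto_components (q := id) (l := 𝓝 q) (p := q) tendsto_id
  exact (h1.sub h2).prodMk_nhds
    (h4.sub ((hf.continuous.tendsto (q.fst.fst, q.fst.snd.snd)).comp (h1.prodMk_nhds h3)))

/-- Regular normals to the graph of the sweeping mapping under linear independence. -/
theorem mem_limitingNormalCone_graph_sweepingMap
    (hf : ContDiff ℝ 1 (fun p : Euc n × Euc d => f p.1 p.2))
    {x u : Euc n} {a : Euc d} {b : Fin m → Euc n} (hx : x - u ∈ polyhedron xs)
    (hb : ∀ i ∈ activeIdx xs (x - u), ∀ j ∈ activeIdx xs (x - u),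
      inner ℝ (xs j) (b i) = if j = i then 1 else 0)
    {l : Fin m → ℝ} (hl : ∀ i, 0 ≤ l i) (hsupp : ∀ i, l i ≠ 0 → inner ℝ (xs i) (x - u) = 0)
    {γ : Fin m → ℝ} (hγ : ∀ i, γ i ≠ 0 → inner ℝ (xs i) (x - u) = 0) {y : Euc n}
    (hpos : ∀ i, 0 < l i → inner ℝ (xs i) y = 0)
    (hzero : ∀ i ∈ activeIdx xs (x - u), l i = 0 → 0 ≤ inner ℝ (xs i) y ∧ 0 ≤ γ i) :
    WithLp.toLp 2 (triple (gradXAdj f x a y + ∑ i, γ i • xs i) (-∑ i, γ i • xs i)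
      (gradAAdj f x a y), -y) ∈ limitingNormalCone (graph (sweepingMap xs f))
        (WithLp.toLp 2 (triple x u a, ∑ i, l i • xs i + f x a)) := by
  set p : WithLp 2 (Triple n d × Euc n) :=
    WithLp.toLp 2 (triple x u a, ∑ i, l i • xs i + f x a) with hp
  refine mem_limitingNormalCone_of_frechet (isClosed_graph_sweepingMap hf)
    (mem_graph_sweepingMap_iff.2 ?_) fun ε hε => ?_
  · refine mem_convexNormalCone_polyhedron_iff.2 ⟨hx, l, hl, hsupp, ?_⟩
    exact add_sub_cancel_right _ _
  have hy : 0 < ‖y‖ + 1 := by positivity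
  let L : WithLp 2 (Triple n d × Euc n) →L[ℝ] Euc n × Euc d :=
    (((WithLp.fstL 2 ℝ (Euc n) (WithLp 2 (Euc n × Euc d))).comp
      (WithLp.fstL 2 ℝ (Triple n d) (Euc n)))).prod
    ((WithLp.sndL 2 ℝ (Euc n) (Euc d)).comp
      ((WithLp.sndL 2 ℝ (Euc n) (WithLp 2 (Euc n × Euc d))).comp
        (WithLp.fstL 2 ℝ (Triple n d) (Euc n))))
  have hD : HasFDerivAt (fun q => f (L q).1 (L q).2) ((totalDeriv f x a).comp L) p :=
    HasFDerivAt.comp (g := fun r : Euc n × Euc d => f r.1 r.2) (f := L) p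
      (hasFDerivAt_totalDeriv hf x a) L.hasFDerivAt
  have hrem := hD.isLittleO.def (c := ε / (‖y‖ + 1)) (by positivity)
  obtain ⟨h1, h2, h3, h4⟩ := tendsto_components (q := id) (l := 𝓝 p) (p := p) tendsto_id
  have hx' := (h1.sub h2)
  have hv' := h4.sub ((hf.continuous.tendsto (x, a)).comp (h1.prodMk_nhds h3))
  have hv'' : Tendsto (fun q : WithLp 2 (Triple n d × Euc n) =>
      q.snd - f q.fst.fst q.fst.snd.snd) (𝓝 p) (𝓝 (∑ i, l i • xs i)) := by
    have e : ∑ i, l i • xs i = p.snd - f x a := (add_sub_cancel_right _ _).symm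
    rw [e]
    exact hv'
  have hmul := eventually_multipliers_pos (x := x - u) hb hsupp hx' hv''
  have hact := hx'.eventually (eventually_activeIdx_subset (xs := xs) (x - u))
  filter_upwards [hrem.filter_mono nhdsWithin_le_nhds, hmul.filter_mono nhdsWithin_le_nhds,
    hact.filter_mono nhdsWithin_le_nhds, self_mem_nhdsWithin] with q hqrem hqmul hqact hqΩ
  obtain ⟨hqx, l', hl', hsupp', hvl'⟩ :=
    mem_convexNormalCone_polyhedron_iff.1 (mem_graph_sweepingMap_iff.1 hqΩ)
  have hpos' := hqmul l' hsupp' hvl'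
  -- Where lᵢ > 0 the nearby multiplier is positive too, so the constraint stays active and the term
  -- vanishes; elsewhere γᵢ ≥ 0 meets feasibility.
  have hη : inner ℝ (∑ i, γ i • xs i) ((q.fst.fst - q.fst.snd.fst) - (x - u)) ≤ 0 := by
    rw [sum_inner]
    refine Finset.sum_nonpos fun i _ => ?_
    rw [real_inner_smul_left]
    by_cases hi : γ i = 0
    · simp [hi]
    rw [inner_sub_right, hγ i hi, sub_zero]
    rcases (hl i).eq_or_lt with hli | hli
    · exact mul_nonpos_of_nonneg_of_nonpos
        (hzero i (mem_activeIdx.2 (hγ i hi)) hli.symm).2 (hqx i)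
    · rw [hsupp' i (hpos' i hli).ne', mul_zero]
  -- Only indices with lᵢ = 0 contribute; there the multiplier can only grow, and ⟨x*ᵢ, y⟩ ≥ 0
  -- whenever it does.
  have hdv : 0 ≤ inner ℝ y (∑ i, l' i • xs i - ∑ i, l i • xs i) := by
    rw [← Finset.sum_sub_distrib, inner_sum]
    refine Finset.sum_nonneg fun i _ => ?_
    rw [← sub_smul, real_inner_smul_right, real_inner_comm]
    rcases (hl i).eq_or_lt with hli | hli
    · rw [← hli, sub_zero]
      by_cases hi : l' i = 0
      · simp [hi]
      · exact mul_nonneg (hl' i)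
          (hzero i (hqact (mem_activeIdx.2 (hsupp' i hi))) hli.symm).1
    · rw [hpos i hli, mul_zero]
  set R := f q.fst.fst q.fst.snd.snd - f x a -
    totalDeriv f x a (q.fst.fst - x, q.fst.snd.snd - a) with hR
  have hRn : ‖R‖ ≤ ε / (‖y‖ + 1) * ‖q - p‖ := hqrem
  have hyR : -inner ℝ y R ≤ ε * ‖q - p‖ := by
    calc -inner ℝ y R ≤ ‖y‖ * ‖R‖ := (neg_le_abs _).trans (abs_real_inner_le_norm _ _)
      _ ≤ (‖y‖ + 1) * (ε / (‖y‖ + 1) * ‖q - p‖) := by gcongr; linarith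
      _ = ε * ‖q - p‖ := by field_simp
  have hsplit : totalDeriv f x a (q.fst.fst - x, q.fst.snd.snd - a) =
      totalDeriv f x a (q.fst.fst - x, 0) + totalDeriv f x a (0, q.fst.snd.snd - a) := by
    rw [← map_add]; simp
  have hq2 : q.snd = ∑ i, l' i • xs i + f q.fst.fst q.fst.snd.snd := by
    rw [← hvl', sub_add_cancel]
  have hinner : inner ℝ (WithLp.toLp 2 (triple (gradXAdj f x a y + ∑ i, γ i • xs i)
      (-∑ i, γ i • xs i) (gradAAdj f x a y), -y) : WithLp 2 (Triple n d × Euc n)) (q - p) =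
      (inner ℝ (gradXAdj f x a y + ∑ i, γ i • xs i) (q.fst.fst - x) +
        (inner ℝ (-∑ i, γ i • xs i) (q.fst.snd.fst - u) +
          inner ℝ (gradAAdj f x a y) (q.fst.snd.snd - a))) +
        inner ℝ (-y) (q.snd - (∑ i, l i • xs i + f x a)) := by
    simp only [WithLp.prod_inner_apply]
    rfl
  rw [hinner]
  have hy2 : inner ℝ y (q.snd - (∑ i, l i • xs i + f x a)) =
      inner ℝ y (∑ i, l' i • xs i - ∑ i, l i • xs i) + inner ℝ y R +
        inner ℝ y (totalDeriv f x a (q.fst.fst - x, 0)) +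
        inner ℝ y (totalDeriv f x a (0, q.fst.snd.snd - a)) := by
    rw [← inner_add_right, ← inner_add_right, ← inner_add_right, hR, hsplit, hq2]
    congr 1
    abel
  have hη2 : inner ℝ (∑ i, γ i • xs i) ((q.fst.fst - q.fst.snd.fst) - (x - u)) =
      inner ℝ (∑ i, γ i • xs i) (q.fst.fst - x) -
        inner ℝ (∑ i, γ i • xs i) (q.fst.snd.fst - u) := by
    rw [← inner_sub_right]
    congr 1
    abel
  rw [inner_add_left, inner_neg_left, inner_neg_left, inner_gradXAdj hf, inner_gradAAdj hf, hy2]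
  linarith

/-- Under linear independence of the active constraints the coderivative contains the explicit
set. -/
theorem explicitSet_subset_coderivative
    (hf : ContDiff ℝ 1 (fun p : Euc n × Euc d => f p.1 p.2))
    {x u : Euc n} {a : Euc d} {w y : Euc n}
    (hw : w ∈ sweepingMap xs f (triple x u a))
    (hli : LinearIndepOn ℝ xs (activeIdx xs (x - u) : Set (Fin m)))
    (hy : y ∈ coderivativeDom (normalMap xs) (x - u) (w - f x a)) :
    explicitSet xs f x u a y ⊆ coderivative (sweepingMap xs f) (triple x u a) w y := by
  classical
  rintro _ ⟨γ, hγ, rfl⟩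
  obtain ⟨v, hvN, rfl⟩ := hw
  change v ∈ convexNormalCone (polyhedron xs) (x - u) at hvN
  change y ∈ coderivativeDom (normalMap xs) (x - u) (v + f x a - f x a) at hy
  rw [add_sub_cancel_right] at hy
  obtain ⟨hx, l, hl, hsupp, rfl⟩ := mem_convexNormalCone_polyhedron_iff.1 hvN
  obtain ⟨b, hb⟩ := exists_biorthogonal hli
  simp only [Finset.mem_coe] at hb
  have hly : ∀ i, 0 < l i → inner ℝ (xs i) y = 0 := fun i hi =>
    inner_eq_zero_of_mem_coderivativeDom hb hsupp hy hi
  set S := idxZero xs (x - u) y ∪ idxPos xs (x - u) y with hS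
  have hmemS : ∀ i, i ∈ S ↔ i ∈ activeIdx xs (x - u) ∧ 0 ≤ inner ℝ (xs i) y := by
    intro i
    simp only [hS, idxZero, idxPos, Finset.mem_union, Finset.mem_filter, ← and_or_left]
    rw [le_iff_eq_or_lt, eq_comm]
  set γ' : Fin m → ℝ := fun i => if i ∈ S then γ i else 0 with hγ'
  have hsum : ∑ i ∈ S, γ i • xs i = ∑ i, γ' i • xs i := by
    simp [hγ', ite_smul, Finset.sum_ite_mem]
  rw [hsum]
  set N : Finset (Fin m) := {i ∈ activeIdx xs (x - u) | inner ℝ (xs i) y < 0} with hN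
  -- This direction makes exactly the active constraints with ⟨x*ᵢ, y⟩ < 0 inactive and keeps the
  -- other active ones at equality.
  set h : Euc n := -∑ i ∈ N, b i with hh
  have hih : ∀ i ∈ activeIdx xs (x - u), inner ℝ (xs i) h = if i ∈ N then -1 else 0 := by
    intro i hi
    rw [hh, inner_neg_right, inner_sum]
    rw [Finset.sum_congr rfl fun j hj => hb j (Finset.mem_filter.1 hj).1 i hi]
    rw [Finset.sum_ite_eq]
    split_ifs <;> simp
  -- Raising the multipliers on I₀(y) makes all of them positive, which frees the sign of γᵢ there
  -- in the Fréchet normal criterion.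
  set δ : Fin m → ℝ := fun i => if i ∈ idxZero xs (x - u) y then 1 else 0 with hδ
  let t : ℕ → ℝ := fun k => 1 / ((k : ℝ) + 1)
  have ht : Tendsto t atTop (𝓝 0) := tendsto_one_div_add_atTop_nhds_zero_nat
  have ht0 : ∀ k, 0 < t k := fun k => by positivity
  have ht' : Tendsto t atTop (𝓝[>] 0) :=
    tendsto_nhdsWithin_iff.2 ⟨ht, Eventually.of_forall ht0⟩
  let X : ℕ → Euc n := fun k => x + t k • h
  have hX : Tendsto X atTop (𝓝 x) := by simpa using (ht.smul_const h).const_add x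
  let l' : ℕ → Fin m → ℝ := fun k i => l i + t k * δ i
  have hl'lim : Tendsto (fun k => ∑ i, l' k i • xs i) atTop (𝓝 (∑ i, l i • xs i)) := by
    refine tendsto_finsetSum _ fun i _ => ?_
    simpa using ((ht.mul_const (δ i)).const_add (l i)).smul_const (xs i)
  have htoLp : ∀ {E F : Type} [NormedAddCommGroup E] [NormedSpace ℝ E] [NormedAddCommGroup F]
      [NormedSpace ℝ F] {g : ℕ → E} {g' : ℕ → F} {z : E} {z' : F}, Tendsto g atTop (𝓝 z) →
      Tendsto g' atTop (𝓝 z') →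
      Tendsto (fun k => WithLp.toLp 2 (g k, g' k)) atTop (𝓝 (WithLp.toLp 2 (z, z'))) := by
    intro E F _ _ _ _ g g' z z' hg hg'
    exact ((WithLp.prodContinuousLinearEquiv 2 ℝ E F).symm.continuous.tendsto (z, z')).comp
      (hg.prodMk_nhds hg')
  have hfX : Tendsto (fun k => f (X k) a) atTop (𝓝 (f x a)) :=
    (hf.continuous.tendsto (x, a)).comp (hX.prodMk_nhds tendsto_const_nhds)
  refine mem_limitingNormalCone_of_tendsto
    (q := fun k => WithLp.toLp 2 (triple (X k) u a, ∑ i, l' k i • xs i + f (X k) a))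
    (ν := fun k => WithLp.toLp 2 (triple (gradXAdj f (X k) a y + ∑ i, γ' i • xs i)
      (-∑ i, γ' i • xs i) (gradAAdj f (X k) a y), -y))
    (mem_graph_sweepingMap_iff.2 ?_)
    (htoLp (htoLp hX tendsto_const_nhds) (hl'lim.add hfX))
    (htoLp (htoLp ((((continuous_gradXAdj hf a y).tendsto x).comp hX).add tendsto_const_nhds)
      (htoLp tendsto_const_nhds (((continuous_gradAAdj hf a y).tendsto x).comp hX)))
      tendsto_const_nhds) ?_
  · exact (add_sub_cancel_right (∑ i, l i • xs i) (f x a)).symm ▸ hvN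
  have hXu : ∀ k, X k - u = (x - u) + t k • h := fun k => by simp only [X]; abel
  have hXulim : Tendsto (fun k => X k - u) atTop (𝓝 (x - u)) := hX.sub_const u
  filter_upwards [ht'.eventually (eventually_add_smul_mem_polyhedron hx (h := h) fun i hi => by
      rw [hih i hi]; split_ifs <;> norm_num),
    hXulim.eventually (eventually_activeIdx_subset (xs := xs) (x - u))] with k hkC hkact
  have hactS : ∀ i, inner ℝ (xs i) (X k - u) = 0 ↔ i ∈ S := by
    intro i
    rw [hmemS]
    have key : i ∈ activeIdx xs (x - u) →
        (inner ℝ (xs i) (X k - u) = 0 ↔ 0 ≤ inner ℝ (xs i) y) := by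
      intro hi
      rw [hXu, inner_add_right, mem_activeIdx.1 hi, zero_add, real_inner_smul_right, hih i hi]
      by_cases hneg : inner ℝ (xs i) y < 0
      · have : i ∈ N := Finset.mem_filter.2 ⟨hi, hneg⟩
        simp [this, (ht0 k).ne', hneg]
      · have : i ∉ N := fun hc => hneg (Finset.mem_filter.1 hc).2
        simp [this, not_lt.1 hneg]
    exact ⟨fun h0 => have hi := hkact (mem_activeIdx.2 h0); ⟨hi, (key hi).1 h0⟩,
      fun hi => (key hi.1).2 hi.2⟩
  have hδ0 : ∀ i, 0 ≤ δ i := fun i => by simp only [hδ]; split_ifs <;> norm_num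
  have hl'0 : ∀ i, 0 ≤ l' k i := fun i => add_nonneg (hl i) (mul_nonneg (ht0 k).le (hδ0 i))
  have hl'Z : ∀ i, l' k i ≠ 0 ↔ i ∈ idxZero xs (x - u) y := by
    intro i
    constructor
    · intro hne
      by_contra hcon
      have hli0 : l i ≠ 0 := by simpa [l', hδ, hcon] using hne
      exact hcon (Finset.mem_filter.2 ⟨mem_activeIdx.2 (hsupp i hli0),
        hly i (lt_of_le_of_ne (hl i) hli0.symm)⟩)
    · intro hi
      have : l' k i = l i + t k := by simp [l', hδ, hi]
      rw [this]
      exact (add_pos_of_nonneg_of_pos (hl i) (ht0 k)).ne'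
  refine mem_limitingNormalCone_graph_sweepingMap hf (b := b) (by rw [hXu]; exact hkC)
    (fun i hi j hj => hb i (hkact hi) j (hkact hj)) hl'0
    (fun i hi => (hactS i).2 (Finset.mem_union_left _ ((hl'Z i).1 hi)))
    (fun i hi => (hactS i).2 ?_)
    (fun i hi => (Finset.mem_filter.1 ((hl'Z i).1 hi.ne')).2) fun i hi hli0 => ?_
  · by_contra hcon
    simp [hγ', hcon] at hi
  · have hiS := (hactS i).1 (mem_activeIdx.1 hi)
    refine ⟨((hmemS i).1 hiS).2, ?_⟩
    have hnz : i ∉ idxZero xs (x - u) y := fun hc => (hl'Z i).2 hc hli0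
    have hpos := (Finset.mem_union.1 hiS).resolve_left hnz
    simpa [hγ', hiS] using hγ i hpos

end Lower

end Sweeping

theorem mainTheorem5 {n m d : ℕ} (xs : Fin m → Sweeping.Euc n)
    (f : Sweeping.Euc n → Sweeping.Euc d → Sweeping.Euc n)
    (hf : ContDiff ℝ 1 (fun p : Sweeping.Euc n × Sweeping.Euc d => f p.1 p.2))
    (x u : Sweeping.Euc n) (a : Sweeping.Euc d) (w : Sweeping.Euc n)
    (hw : w ∈ Sweeping.sweepingMap xs f (Sweeping.triple x u a)) :
    (∀ y ∈ Sweeping.coderivativeDom (Sweeping.normalMap xs) (x - u) (w - f x a),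
      Sweeping.coderivative (Sweeping.sweepingMap xs f) (Sweeping.triple x u a) w y ⊆
        Sweeping.explicitSet xs f x u a y) ∧
    (LinearIndepOn ℝ xs (Sweeping.activeIdx xs (x - u) : Set (Fin m)) →
      ∀ y ∈ Sweeping.coderivativeDom (Sweeping.normalMap xs) (x - u) (w - f x a),
        Sweeping.coderivative (Sweeping.sweepingMap xs f) (Sweeping.triple x u a) w y =
          Sweeping.explicitSet xs f x u a y) :=
  ⟨fun y _ => Sweeping.coderivative_sweepingMap_subset hf x u a w y, fun hli y hy =>
    (Sweeping.coderivative_sweepingMap_subset hf x u a w y).antisymm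
      (Sweeping.explicitSet_subset_coderivative hf hw hli hy)⟩
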